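/- Fix a field $k$. For a finite poset $\mathcal P$, let $\operatorname{mod}\mathcal P$ be the category of functors from $\mathcal P$ to finite-dimensional $k$-vector spaces, $\operatorname{Ind}\mathcal P$ a set of representatives of the isomorphism classes of its indecomposable objects, and $\mathrm K_0^{\mathrm{sp}}(\mathcal P)$ its split Grothendieck group (the free abelian group on isomorphism classes $[M]$ modulo $[M\oplus N]=[M]+[N]$). Call $\mathcal P$ representation-finite if $\operatorname{Ind}\mathcal P$ is finite. Let $\mathcal X$ be a representation-finite finite poset, $\mathrm I=\operatorname{Ind}\mathcal X$, and let $\mathcal P$ be a finite poset. Let $\mathrm{Emb}_{\mathcal X}^{\mathcal P}$ be the set of order-embeddings $\mathcal X\to\mathcal P$ up to automorphisms of $\mathcal X$ (for each class a representative is fixed), and let $\mathrm E\subseteq\mathrm{Emb}_{\mathcal X}^{\mathcal P}$. For $f\in\mathrm E$ let $f^*:\operatorname{mod}\mathcal P\to\operatorname{mod}\mathcal X$ be restriction along $f$ and $f_!$ its left adjoint. Define $\mathbb Z$-linear maps $\mathbf{dimh}^{\mathrm E}_{\mathcal X,\mathcal P},\ \mathbf{mult}^{\mathrm E}_{\mathcal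 X,\mathcal P}:\mathrm K_0^{\mathrm{sp}}(\mathcal P)\to\mathbb Z^{\mathrm E\times\mathrm I}$ by $$\mathbf{dimh}^{\mathrm E}_{\mathcal X,\mathcal P}(M)_{(f,U)}=\dim_k\operatorname{Hom}_{\mathcal X}(U,f^*M),\qquad \mathbf{mult}^{\mathrm E}_{\mathcal X,\mathcal P}(M)_{(f,U)}=\text{the multiplicity of }U\text{ in a decomposition of } f^*M \text{ into indecomposables}.$$ Write $(f,U)\sim_!(g,V)$ if $f_!U\cong g_!V$. A set $\mathcal B$ of (isomorphism classes of) indecomposable $\mathcal P$-modules is a basis of a $\mathbb Z$-linear map $\Psi:\mathrm K_0^{\mathrm{sp}}(\mathcal P)\to\mathbb Z^N$ with finitely generated image if $\Psi$ restricts to an isomorphism from the subgroup $\langle[U]: U\in\mathcal B\rangle$ onto $\operatorname{Im}\Psi$. Assume that $\bigcup_{f\in\mathrm E}\operatorname{Im}f=\mathcal P$ and that the Gabriel quiver of the algebra $\operatorname{End}_{\mathcal P}\bigl(\bigoplus_{(f,U)\in(\mathrm E\times\mathrm I)/\sim_!}f_!U\bigr)$ has no oriented cycle. Then the set $\{f_!U\mid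 (f,U)\in(\mathrm E\times\mathrm I)/{\sim_!}\}$ is a basis of $\mathbf{dimh}^{\mathrm E}_{\mathcal X,\mathcal P}$, and hence also of $\mathbf{mult}^{\mathrm E}_{\mathcal X,\mathcal P}$. -/

import Mathlib

open CategoryTheory CategoryTheory.Limits

universe u v w

noncomputable section

/-! ### Modules over a finite poset -/

/-- The category `mod P` of functors from the poset `P` to finite-dimensional `k`-vector spaces. -/
abbrev PosetMod (k : Type u) [Field k] (P : Type v) [PartialOrder P] :=
  P ⥤ FGModuleCat.{u} k

instance (k : Type u) [Field k] (P : Type v) [PartialOrder P] :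
    HasFiniteBiproducts (PosetMod k P) := Abelian.hasFiniteBiproducts

/-- The set of isomorphism classes of objects of a category. -/
abbrev IsoClass (C : Type v) [Category.{w} C] := Quotient (isIsomorphicSetoid C)

/-- The isomorphism class of an object. -/
abbrev isoClass {C : Type v} [Category.{w} C] (M : C) : IsoClass C :=
  Quotient.mk (isIsomorphicSetoid C) M

/-- `Ind P`: the isomorphism classes of indecomposable `P`-modules. -/
def IndecClass (k : Type u) [Field k] (P : Type v) [PartialOrder P] :=
  {c : IsoClass (PosetMod k P) // Indecomposable c.out}

/-- The chosen representative of a class in `Ind P`. -/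
def IndecClass.rep {k : Type u} [Field k] {P : Type v} [PartialOrder P] (U : IndecClass k P) : PosetMod k P :=
  U.1.out

/-- A poset is representation-finite over `k` if it has, up to isomorphism, only finitely many
indecomposable modules. -/
class IsRepFinite (k : Type u) [Field k] (P : Type v) [PartialOrder P] : Prop where
  finite_ind : Finite (IndecClass k P)

instance (k : Type u) [Field k] (P : Type v) [PartialOrder P] [IsRepFinite k P] :
    Finite (IndecClass k P) := IsRepFinite.finite_ind

/-! ### The split Grothendieck group, invariants and their bases -/

section Invariants

variable (C : Type v) [Category.{w} C] [Preadditive C] [HasBinaryBiproducts C]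

/-- The relations `[M ⊕ N] - ([M] + [N])`. -/
def splitRelations : AddSubgroup (FreeAbelianGroup (IsoClass C)) :=
  AddSubgroup.closure (Set.range fun MN : C × C =>
    FreeAbelianGroup.of (isoClass (MN.1 ⊞ MN.2)) -
      (FreeAbelianGroup.of (isoClass MN.1) + FreeAbelianGroup.of (isoClass MN.2)))

/-- The split Grothendieck group of `C`: the free abelian group on the isomorphism classes of
objects modulo the relations `[M ⊕ N] = [M] + [N]`. -/
abbrev SplitK0 := FreeAbelianGroup (IsoClass C) ⧸ splitRelations C

variable {C}

/-- The element of the split Grothendieck group given by an isomorphism class. -/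
def SplitK0.of (c : IsoClass C) : SplitK0 C :=
  QuotientAddGroup.mk (FreeAbelianGroup.of c)

/-- A map from objects to `ℤ^N` that is constant on isomorphism classes and additive on direct
sums. -/
structure IsAdditiveInvariant {N : Type*} (φ : C → N → ℤ) : Prop where
  map_iso : ∀ M M' : C, Nonempty (M ≅ M') → φ M = φ M'
  map_biprod : ∀ M M' : C, φ (M ⊞ M') = φ M + φ M'

/-- The `ℤ`-linear map on the split Grothendieck group, `[M] ↦ φ M`, given by an additive
invariant `φ`. -/
def IsAdditiveInvariant.toHom {N : Type*} {φ : C → N → ℤ} (h : IsAdditiveInvariant φ) :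
    SplitK0 C →+ (N → ℤ) :=
  QuotientAddGroup.lift (splitRelations C)
    (FreeAbelianGroup.lift fun c : IsoClass C =>
      Quotient.lift (s := isIsomorphicSetoid C) φ (fun M M' e => h.map_iso M M' e) c)
    (by
      rw [splitRelations, AddSubgroup.closure_le]
      rintro _ ⟨⟨M, M'⟩, rfl⟩
      simp [isoClass, h.map_biprod])

theorem IsAdditiveInvariant.toHom_of {N : Type*} {φ : C → N → ℤ} (h : IsAdditiveInvariant φ)
    (M : C) : h.toHom (SplitK0.of (isoClass M)) = φ M := by
  simp [IsAdditiveInvariant.toHom, SplitK0.of, isoClass]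

/-- The subgroup `⟨[U] : U ∈ B⟩` of the split Grothendieck group. -/
def spanClasses (B : Set (IsoClass C)) : AddSubgroup (SplitK0 C) :=
  AddSubgroup.closure (SplitK0.of '' B)

/-- A set `B` of isomorphism classes of objects is a basis of the (finite) invariant `Ψ` if its
members are indecomposable and `Ψ` restricts to an isomorphism from `⟨[U] : U ∈ B⟩` onto the image
of `Ψ`. -/
structure IsInvariantBasis {N : Type*} (Ψ : SplitK0 C →+ (N → ℤ)) (B : Set (IsoClass C)) :
    Prop where
  finite_invariant : Ψ.range.FG
  indecomposable : ∀ c ∈ B, Indecomposable c.out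
  bijective : Function.Bijective (Ψ.rangeRestrict.comp (spanClasses B).subtype)

end Invariants

/-! ### Order-embeddings, restriction and its left adjoint -/

/-- Two order-embeddings `X → P` are identified if they differ by an automorphism of `X`. -/
def embSetoid (X : Type v) (P : Type w) [PartialOrder X] [PartialOrder P] : Setoid (X ↪o P) where
  r f g := ∃ σ : X ≃o X, ∀ x, g x = f (σ x)
  iseqv :=
    { refl := fun f => ⟨OrderIso.refl X, fun _ => rfl⟩
      symm := by
        rintro f g ⟨σ, h⟩
        exact ⟨σ.symm, fun x => by simp [h]⟩
      trans := by
        rintro f g l ⟨σ, h⟩ ⟨τ, h'⟩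
        exact ⟨τ.trans σ, fun x => by simp [h, h']⟩ }

/-- `Emb_X^P`: order-embeddings of `X` into `P` up to automorphism of `X`. -/
def Emb (X : Type v) (P : Type w) [PartialOrder X] [PartialOrder P] := Quotient (embSetoid X P)

/-- The chosen order-embedding representing a class. -/
def Emb.rep {X : Type v} {P : Type w} [PartialOrder X] [PartialOrder P] (f : Emb X P) : X ↪o P :=
  Quotient.out f

instance (X : Type v) (P : Type w) [PartialOrder X] [PartialOrder P] [Finite X] [Finite P] :
    Finite (Emb X P) := by
  have : Finite (X ↪o P) := Finite.of_injective (fun f : X ↪o P => (f : X → P)) DFunLike.coe_injective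
  unfold Emb
  infer_instance

section Kan

variable (k : Type u) [Field k] {X : Type v} {P : Type w} [PartialOrder X] [PartialOrder P]

/-- The restriction functor `f^* : mod P → mod X`. -/
abbrev restrict (f : X ↪o P) : PosetMod k P ⥤ PosetMod k X :=
  (Functor.whiskeringLeft X P (FGModuleCat.{u} k)).obj f.monotone.functor

/-- The comparison of the poset `{x | f x ≤ p}` with the comma category `f ↓ p`. -/
def belowFunctor (f : X ↪o P) (p : P) :
    {x : X // f x ≤ p} ⥤ CostructuredArrow f.monotone.functor p where
  obj x := CostructuredArrow.mk (Y := x.1) (homOfLE x.2)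
  map {x y} h := CostructuredArrow.homMk (homOfLE (leOfHom h)) (Subsingleton.elim _ _)

instance (f : X ↪o P) (p : P) : (belowFunctor f p).IsEquivalence where
  faithful := ⟨fun _ => Subsingleton.elim _ _⟩
  full := ⟨fun {x y} h => ⟨homOfLE (show x.1 ≤ y.1 from leOfHom h.left), by
    ext; exact Subsingleton.elim _ _⟩⟩
  essSurj := ⟨fun c => ⟨⟨c.left, leOfHom c.hom⟩, ⟨CostructuredArrow.isoMk (Iso.refl _)
    (Subsingleton.elim _ _)⟩⟩⟩

instance [Finite X] (f : X ↪o P) (p : P) :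
    HasColimitsOfShape (CostructuredArrow f.monotone.functor p) (FGModuleCat.{u} k) := by
  classical
  have : Fintype {x : X // f x ≤ p} := Fintype.ofFinite _
  have : FinCategory {x : X // f x ≤ p} :=
    { fintypeObj := inferInstance
      fintypeHom := fun x y => Fintype.ofFinite _ }
  have := hasColimitsOfShape_of_hasFiniteColimits (C := FGModuleCat.{u} k) {x : X // f x ≤ p}
  exact hasColimitsOfShape_of_equivalence (belowFunctor f p).asEquivalence

/-- The left adjoint `f_! : mod X → mod P` of the restriction functor, that is, left Kan extension
along `f`. -/
def shriek [Finite X] (f : X ↪o P) : PosetMod k X ⥤ PosetMod k P :=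
  f.monotone.functor.lan

/-- `f_!` is left adjoint to `f^*`. -/
def shriekAdjunction [Finite X] (f : X ↪o P) : shriek k f ⊣ restrict k f :=
  f.monotone.functor.lanAdjunction (FGModuleCat.{u} k)

end Kan

/-! ### The invariants `dimh` and `mult` attached to a set of order-embeddings -/

section EmbInvariants

variable (k : Type u) [Field k] {X : Type v} {P : Type w} [PartialOrder X] [PartialOrder P]

instance [Finite P] (M N : PosetMod k P) : Module.Finite k (M ⟶ N) := by
  let ev : (M ⟶ N) →ₗ[k] (∀ p, M.obj p ⟶ N.obj p) :=
    { toFun := fun φ p => φ.app p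
      map_add' := fun _ _ => rfl
      map_smul' := fun _ _ => rfl }
  exact Module.Finite.of_injective ev fun φ ψ h => NatTrans.ext h

/-- `M ↦ (dim_k Hom_X(U, f^* M))_{(f, U)}`. -/
def dimhFun (E : Set (Emb X P)) (M : PosetMod k P) (i : E × IndecClass k X) : ℤ :=
  (Module.finrank k (i.2.rep ⟶ (restrict k i.1.1.rep).obj M) : ℤ)

theorem dimhFun_isAdditiveInvariant [Finite X] (E : Set (Emb X P)) :
    IsAdditiveInvariant (dimhFun k E) where
  map_iso := by
    rintro M M' ⟨e⟩
    funext i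
    have e' := (restrict k i.1.1.rep).mapIso e
    exact congrArg Nat.cast (LinearEquiv.finrank_eq (Linear.homCongr k (Iso.refl _) e'))
  map_biprod := by
    intro M M'
    funext i
    have : (restrict k i.1.1.rep).Additive := ⟨rfl⟩
    have := preservesBinaryBiproducts_of_preservesBiproducts (restrict k i.1.1.rep)
    have e' := (restrict k i.1.1.rep).mapBiprod M M'
    have h1 := LinearEquiv.finrank_eq (Linear.homCongr k (Iso.refl i.2.rep) e')
    let F := restrict k i.1.1.rep
    let s : (i.2.rep ⟶ F.obj M ⊞ F.obj M') ≃ₗ[k]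
        (i.2.rep ⟶ F.obj M) × (i.2.rep ⟶ F.obj M') :=
      { toFun := fun g => (g ≫ biprod.fst, g ≫ biprod.snd)
        map_add' := fun _ _ => by simp
        map_smul' := fun _ _ => by simp
        invFun := fun g => biprod.lift g.1 g.2
        left_inv := fun g => by apply biprod.hom_ext <;> simp
        right_inv := fun g => by simp }
    have h2 := s.finrank_eq
    rw [Module.finrank_prod] at h2
    have h3 := h1.trans h2
    simp only [dimhFun, Pi.add_apply]
    exact_mod_cast h3

/-- The invariant `dimh^E_{X,P} : K_0^sp(P) → ℤ^{E × Ind X}`. -/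
def dimh [Finite X] (E : Set (Emb X P)) : SplitK0 (PosetMod k P) →+ (E × IndecClass k X → ℤ) :=
  (dimhFun_isAdditiveInvariant k E).toHom

variable {k}

/-- `M ≅ ⨁_{U ∈ Ind X} U^{α_U}`. -/
def IsDecomposition (M : PosetMod k X) (α : IndecClass k X →₀ ℕ) : Prop :=
  Nonempty (M ≅ ⨁ fun i : (U : α.support) × Fin (α U) => i.1.1.rep)

open Classical in
/-- The multiplicities `α_U` in a decomposition `M ≅ ⨁_{U ∈ Ind X} U^{α_U}` into
indecomposables. -/
def decompMult (M : PosetMod k X) : IndecClass k X →₀ ℕ :=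
  if h : ∃ α, IsDecomposition M α then h.choose else 0

variable (k)

/-- `M ↦ (mult_X(U, f^* M))_{(f, U)}`. When it is an additive invariant, the linear map on
`K_0^sp(P)` which it induces is `mult^E_{X,P}`. -/
def multFun (E : Set (Emb X P)) (M : PosetMod k P) (i : E × IndecClass k X) : ℤ :=
  (decompMult ((restrict k i.1.1.rep).obj M) i.2 : ℤ)

end EmbInvariants

/-! ### The modules `f_! U` -/

section Shriek

variable (k : Type u) [Field k] {X : Type v} {P : Type w} [PartialOrder X] [PartialOrder P]
  [Finite X]

/-- The module `f_! U` for `(f, U) ∈ E × Ind X`. -/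
def shriekObj (E : Set (Emb X P)) (i : E × IndecClass k X) : PosetMod k P :=
  (shriek k i.1.1.rep).obj i.2.rep

/-- The relation `(f, U) ∼_! (g, V) ↔ f_! U ≅ g_! V` on `E × Ind X`. -/
def shriekSetoid (E : Set (Emb X P)) : Setoid (E × IndecClass k X) :=
  (isIsomorphicSetoid (PosetMod k P)).comap (shriekObj k E)

/-- The index set `(E × Ind X) / ∼_!`. -/
abbrev ShriekIndex (E : Set (Emb X P)) := Quotient (shriekSetoid k E)

/-- The module `f_! U` for the chosen representative `(f, U)` of a `∼_!`-class. -/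
def shriekRep (E : Set (Emb X P)) (q : ShriekIndex k E) : PosetMod k P :=
  shriekObj k E q.out

/-- The set `{f_! U | (f, U) ∈ (E × Ind X) / ∼_!}`, as a set of isomorphism classes. -/
def shriekClasses (E : Set (Emb X P)) : Set (IsoClass (PosetMod k P)) :=
  Set.range fun q : ShriekIndex k E => isoClass (shriekRep k E q)

end Shriek

/-! ### The Gabriel quiver -/

section Gabriel

variable (k : Type u) [Field k] {A : Type v} [Ring A] [Algebra k A] {ι : Type w}

/-- The subspace `e_j (rad A / rad² A) e_i` of `A / rad² A`. -/
def arrowSpace (e : ι → A) (i j : ι) :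
    Submodule k (A ⧸ (Ring.jacobson A * Ring.jacobson A : Ideal A)) :=
  (((Ring.jacobson A).restrictScalars k).map
      (LinearMap.mulLeft k (e j) ∘ₗ LinearMap.mulRight k (e i))).map
    ((Ring.jacobson A * Ring.jacobson A : Ideal A).mkQ.restrictScalars k)

/-- The Gabriel quiver of a finite-dimensional basic `k`-algebra `A` with respect to a complete set
`e` of primitive orthogonal idempotents: the vertices are the indices of the idempotents, and the
number of arrows from `i` to `j` is the dimension of `e_j (rad A / rad² A) e_i`. -/
def GabrielQuiver (_k : Type u) (_e : ι → A) := ι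

instance (e : ι → A) : Quiver (GabrielQuiver k e) where
  Hom i j := Fin (Module.finrank k (arrowSpace k e i j))

/-- A quiver has no oriented cycle if every path from a vertex to itself is trivial. -/
def HasNoOrientedCycle (Q : Type v) [Quiver.{w} Q] : Prop :=
  ∀ (a : Q) (p : Quiver.Path a a), p.length = 0

end Gabriel

/-- The idempotent of `End (⨁ T)` projecting onto the summand `T j`. -/
def summandIdempotent {C : Type v} [Category.{w} C] [HasZeroMorphisms C] {J : Type*} (T : J → C)
    [HasBiproduct T] (j : J) : End (⨁ T) :=
  (biproduct.π T j ≫ biproduct.ι T j : ⨁ T ⟶ ⨁ T)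

/-- The Gabriel quiver of the algebra `End_P(⨁_{(f, U) ∈ (E × Ind X) / ∼_!} f_! U)`. -/
abbrev ShriekGabrielQuiver (k : Type u) [Field k] {X : Type v} {P : Type w} [PartialOrder X]
    [PartialOrder P] [Finite X] [Finite P] [IsRepFinite k X] (E : Set (Emb X P)) :=
  GabrielQuiver k (A := End (⨁ shriekRep k E)) (summandIdempotent (shriekRep k E))

end

noncomputable section

/-! By the adjunction of `f_!` and `f^*`, the coordinate of `dimh` at `(f, U)` is `dim Hom(f_! U,
M)`. Up to repetition of coordinates, `dimh` is therefore `M ↦ (dim Hom(T_q, M))_q`, where `T_q`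
runs over the pairwise non-isomorphic modules `f_! U`; these are indecomposable because `f^* f_! U ≅
U`. The claim thus concerns the integer matrix `h` with entries `dim Hom(T_q, T_q')`.

A non-isomorphism between members of `T` lies in the radical of `End (⨁ T)`. As the radical is
nilpotent, such a morphism can be nonzero only if a nontrivial path of the Gabriel quiver joins the
two vertices (`mul_mul_eq_zero_of_forall_path`, `exists_path_of_not_isIso`). Acyclicity therefore
makes `h` triangular and each `T_q` a brick. The diagonal entries need not be 1, since `k` is
arbitrary, but `Hom(T_q, N)` is a vector space over the division ring `End(T_q)` (up to passing to
the opposite ring), so `h q q` divides `dim Hom(T_q, N)` for every `N`. Dividing row `q` by `h q q`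
leaves a unitriangular integer system: it is solvable for every `M`
(`exists_solution_of_triangular`), and uniquely (`eq_zero_of_triangular`).

For `mult`, the `f`-coordinates of `dimh` are obtained from those of `mult` by the matrix `dim
Hom(U, V)` on `Ind X`. This is a principal submatrix of `h`, hence triangular with nonzero diagonal,
so both maps have the same kernel (`mult_eq_zero_iff`), and the basis property passes from one to
the other. -/

/-! ### Finite-dimensional algebras -/

/-- In a finite-dimensional algebra without nontrivial idempotents, each element is invertible or
nilpotent. -/
theorem isUnit_or_isNilpotent_of_forall_isIdempotentElem (k : Type*) {A : Type*} [Field k] [Ring A]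
    [Algebra k A] [Module.Finite k A] (h : ∀ e : A, IsIdempotentElem e → e = 0 ∨ e = 1) (a : A) :
    IsUnit a ∨ IsNilpotent a := by
  -- The subalgebra `k[a]` is commutative and Artinian, so the powers of `a` stabilise up to
  -- multiples inside it. This yields an idempotent, as in Fitting's lemma.
  let S := Algebra.adjoin k {a}
  have : Module.Finite k S := Module.Finite.of_injective S.val.toLinearMap Subtype.val_injective
  have : IsMulCommutative S := Algebra.isMulCommutative_adjoin k (by simp)
  let : CommRing S := { (inferInstance : Ring S) with mul_comm := mul_comm' }
  have : IsArtinianRing S := IsArtinianRing.of_finite k S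
  let b : S := ⟨a, Algebra.self_mem_adjoin_singleton k a⟩
  obtain ⟨n, y, hy⟩ := IsArtinian.exists_pow_succ_smul_dvd b (1 : S)
  simp only [smul_eq_mul, mul_one] at hy
  have key : ∀ m, ∃ z, b ^ n = b ^ (n + m) * z := by
    intro m
    induction m with
    | zero => exact ⟨1, by simp⟩
    | succ m ih =>
      obtain ⟨z, hz⟩ := ih
      refine ⟨y * z, ?_⟩
      calc b ^ n = b ^ m * b ^ n * z := by rw [← pow_add, add_comm m, ← hz]
        _ = b ^ m * (b ^ n.succ * y) * z := by rw [hy]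
        _ = b ^ (n + (m + 1)) * (y * z) := by rw [Nat.succ_eq_add_one]; ring
  -- The exponent `n + 1`, rather than `n`, makes `b` divide the idempotent `b ^ (n + 1) * z` even
  -- when `n = 0`; otherwise the case where it equals 1 would not show `b` to be a unit.
  obtain ⟨z, hz⟩ := key (n + 1)
  have he : IsIdempotentElem (b ^ (n + 1) * z) := by
    have hz' : b ^ (n + 1) = b ^ (n + 1) * (b ^ (n + 1) * z) := by
      calc b ^ (n + 1) = b * b ^ n := by ring
        _ = b * (b ^ (n + (n + 1)) * z) := by rw [← hz]
        _ = _ := by ring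
    calc b ^ (n + 1) * z * (b ^ (n + 1) * z) = b ^ (n + 1) * (b ^ (n + 1) * z) * z := by ring
      _ = _ := by rw [← hz']
  rcases h _ (he.map S.val) with h0 | h1
  · right
    have h0' : b ^ (n + 1) * z = 0 := Subtype.val_injective h0
    refine ⟨n, ?_⟩
    have : b ^ n = 0 := by
      rw [hz, pow_add, mul_assoc, h0', mul_zero]
    exact congrArg Subtype.val this
  · left
    have h1' : b ^ (n + 1) * z = 1 := Subtype.val_injective h1
    have : IsUnit b := IsUnit.of_mul_eq_one (b ^ n * z) (by rw [← h1']; ring)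
    exact this.map S.val

/-- An element all of whose left multiples are nilpotent lies in the Jacobson radical. -/
theorem Ring.mem_jacobson_of_forall_isNilpotent {A : Type*} [Ring A] {x : A}
    (h : ∀ y, IsNilpotent (y * x)) : x ∈ Ring.jacobson A := by
  rw [← Ideal.jacobson_bot, Ideal.mem_jacobson_iff]
  intro y
  obtain ⟨z, hz⟩ := (h y).isUnit_one_add.exists_left_inv
  refine ⟨z, ?_⟩
  rw [Ideal.mem_bot, ← sub_eq_zero.2 hz]
  noncomm_ring

/-! ### Paths in the Gabriel quiver and powers of the radical -/

section Gabriel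

variable {k : Type*} {A ι : Type*} [Field k] [Ring A] [Algebra k A]

/-- If the vertices `i` and `j` are not joined by an arrow, then `e_j (rad A) e_i ⊆ rad² A`. -/
theorem mul_mul_mem_of_isEmpty_hom [Module.Finite k A] {e : ι → A}
    {i j : ι} (hij : IsEmpty (Quiver.Hom (V := GabrielQuiver k e) i j)) {x : A} (hx : x ∈ Ring.jacobson A) :
    e j * (x * e i) ∈ Ring.jacobson A * Ring.jacobson A := by
  have h0 : Module.finrank k (arrowSpace k e i j) = 0 := by
    by_contra h
    exact hij.false (show Fin _ from ⟨0, Nat.pos_of_ne_zero h⟩)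
  rw [Submodule.finrank_eq_zero] at h0
  have : (Ring.jacobson A * Ring.jacobson A : Ideal A).mkQ (e j * (x * e i)) ∈
      arrowSpace k e i j := ⟨_, ⟨x, hx, rfl⟩, rfl⟩
  rw [h0, Submodule.mem_bot] at this
  exact (Submodule.Quotient.mk_eq_zero _).1 this

/-- If no nontrivial path leads from `i` to `j`, then `e_j (rad A) e_i = 0`. -/
theorem mul_mul_eq_zero_of_forall_path [Module.Finite k A] [Fintype ι] {e : ι → A}
    (he : ∑ i, e i = 1) (hidem : ∀ i, e i * e i = e i) {i j : ι}
    (hij : ∀ p : Quiver.Path (V := GabrielQuiver k e) i j, p.length = 0) {x : A} (hx : x ∈ Ring.jacobson A) :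
    e j * (x * e i) = 0 := by
  have : IsArtinianRing A := IsArtinianRing.of_finite k A
  let J := Ring.jacobson A
  have hJ : ∀ {a : A}, a ∈ J → ∀ b, a * b ∈ J := fun ha b => Ideal.mul_mem_right b J ha
  -- The induction pushes `e_j J e_i` into ever higher powers of `J`, for all pairs without a
  -- nontrivial path at once, since intermediate vertices change the pair.
  have key : ∀ m : ℕ, ∀ i j : ι,
      (∀ p : Quiver.Path (V := GabrielQuiver k e) i j, p.length = 0) → ∀ x ∈ J, e j * (x * e i) ∈ J ^ (m + 1) := by
    intro m
    induction m with
    | zero =>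
      intro i j _ x hx
      rw [zero_add, Submodule.pow_one]
      exact J.mul_mem_left _ (hJ hx _)
    | succ m ih =>
      intro i j hij x hx
      have hemp : IsEmpty (Quiver.Hom (V := GabrielQuiver k e) i j) :=
        ⟨fun a => one_ne_zero (hij (Quiver.Hom.toPath a))⟩
      have hsq : ∀ z ∈ J * J, e j * (z * e i) ∈ J ^ (m + 1 + 1) := by
        intro z hz
        refine Submodule.mul_induction_on hz (fun a ha b hb => ?_) (fun a b ha hb => ?_)
        · have : e j * (a * b * e i) = ∑ l, (e j * (a * e l)) * (e l * (b * e i)) := by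
            have h1 : ∀ l, (e j * (a * e l)) * (e l * (b * e i)) =
                e j * a * e l * (b * e i) := by
              intro l
              simp only [← mul_assoc]
              rw [mul_assoc (e j * a), hidem]
            simp only [h1]
            rw [← Finset.sum_mul, ← Finset.mul_sum, he]
            noncomm_ring
          rw [this]
          refine Submodule.sum_mem _ fun l _ => ?_
          -- Nontrivial paths `i → l` and `l → j` would compose to one from `i` to `j`. So for each
          -- `l` one of the two factors falls under the induction hypothesis, and the other adds one
          -- more power of `J`.
          by_cases h1 : ∀ p : Quiver.Path (V := GabrielQuiver k e) i l, p.length = 0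
          · rw [Submodule.pow_succ' J m.succ_ne_zero]
            exact Ideal.mul_mem_mul (J.mul_mem_left _ (hJ ha _)) (ih i l h1 b hb)
          · by_cases h2 : ∀ p : Quiver.Path (V := GabrielQuiver k e) l j, p.length = 0
            · rw [Submodule.pow_succ]
              exact Ideal.mul_mem_mul (ih l j h2 a ha) (J.mul_mem_left _ (hJ hb _))
            · push Not at h1 h2
              obtain ⟨p, hp⟩ := h1
              obtain ⟨q, hq⟩ := h2
              have := (Quiver.Path.length_comp p q).symm.trans (hij (p.comp q))
              omega
        · rw [add_mul, mul_add]
          exact add_mem ha hb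
      have h2 : e j * (x * e i) = e j * (e j * (x * e i) * e i) := by
        rw [mul_assoc (e j), mul_assoc x, hidem, ← mul_assoc (e j) (e j), hidem]
      rw [h2]
      exact hsq _ (mul_mul_mem_of_isEmpty_hom hemp hx)
  obtain ⟨n, hn⟩ : IsNilpotent J := IsSemiprimaryRing.isNilpotent
  have := key n i j hij x hx
  rw [Submodule.pow_succ, hn, Submodule.zero_eq_bot, Submodule.bot_mul] at this
  exact this

end Gabriel

/-! ### Triangular systems of linear equations -/

section Triangular

variable {Q : Type*} [Fintype Q] {s : Q → Q → Prop} {h : Q → Q → ℤ}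

/-- In row `i` only `n i` and the `n j` with `s j i` can occur; the latter vanish by well-founded
induction. -/
theorem eq_zero_of_triangular (hs : WellFounded s)
    (hh : ∀ i j, i ≠ j → h i j ≠ 0 → s j i) (hd : ∀ i, h i i ≠ 0) {n : Q → ℤ}
    (hn : ∀ i, ∑ j, h i j * n j = 0) : n = 0 := by
  funext i
  induction i using hs.induction with
  | _ i ih =>
    have := hn i
    rw [Finset.sum_eq_single i] at this
    · exact (mul_eq_zero.1 this).resolve_left (hd i)
    · intro j _ hj
      by_cases h0 : h i j = 0
      · rw [h0, zero_mul]
      · rw [ih j (hh i j hj.symm h0), Pi.zero_apply, mul_zero]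
    · simp

/-- Substitution along `s`. Each division by `h i i` is exact because `h i i` divides the whole
`i`-th equation, so no diagonal entry has to be a unit. -/
theorem exists_solution_of_triangular (hs : WellFounded s)
    (hh : ∀ i j, i ≠ j → h i j ≠ 0 → s j i) (hd : ∀ i j, h i i ∣ h i j) {v : Q → ℤ}
    (hv : ∀ i, h i i ∣ v i) : ∃ n : Q → ℤ, ∀ i, ∑ j, h i j * n j = v i := by
  classical
  -- The default value 0 when `s j i` fails is harmless: there `h i j = 0` or `j = i`.
  let n : Q → ℤ := hs.fix fun i rec =>
    (v i - ∑ j, if hj : s j i then (if j = i then 0 else h i j * rec j hj) else 0) / h i i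
  have hn : ∀ i, n i = (v i - ∑ j, if j = i then 0 else h i j * n j) / h i i := by
    intro i
    rw [show n i = _ from hs.fix_eq _ i]
    congr 2
    refine Finset.sum_congr rfl fun j _ => ?_
    by_cases hj : s j i
    · rw [dif_pos hj]
    · rw [dif_neg hj]
      by_cases hji : j = i
      · rw [if_pos hji]
      · rw [if_neg hji, not_not.1 (mt (hh i j (Ne.symm hji)) hj), zero_mul]
  refine ⟨n, fun i => ?_⟩
  have hdvd : h i i ∣ v i - ∑ j, if j = i then 0 else h i j * n j := by
    refine dvd_sub (hv i) (Finset.dvd_sum fun j _ => ?_)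
    split_ifs
    · exact dvd_zero _
    · exact (hd i j).mul_right _
  have h1 : h i i * n i = v i - ∑ j, if j = i then 0 else h i j * n j := by
    rw [hn i, Int.mul_ediv_cancel' hdvd]
  have h2 : ∑ j, h i j * n j = h i i * n i + ∑ j, if j = i then 0 else h i j * n j := by
    rw [← Finset.add_sum_erase _ _ (Finset.mem_univ i),
      ← Finset.add_sum_erase Finset.univ (fun j => if j = i then 0 else h i j * n j)
        (Finset.mem_univ i), if_pos rfl, zero_add]
    congr 1
    exact Finset.sum_congr rfl fun j hj => (if_neg (Finset.ne_of_mem_erase hj)).symm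
  rw [h2, h1, sub_add_cancel]

end Triangular

/-! ### Krull–Schmidt theory in Hom-finite categories -/

section KrullSchmidt

theorem CategoryTheory.End.comp_pow_succ {C : Type*} [Category* C] {M N : C} (a : M ⟶ N) (b : N ⟶ M) (n : ℕ) :
    End.of (a ≫ b) ^ (n + 1) = End.of (a ≫ (End.of (b ≫ a) ^ n).asHom ≫ b) := by
  induction n with
  | zero => simp [End.one_def]
  | succ n ih =>
    rw [pow_succ, ih, pow_succ]
    simp [End.mul_def]

variable {C : Type v} [Category.{w} C] [Preadditive C]

theorem CategoryTheory.Indecomposable.of_iso [HasBinaryBiproducts C] {M N : C}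
    (hM : Indecomposable M) (e : M ≅ N) : Indecomposable N :=
  ⟨fun h => hM.1 (h.of_iso e), fun Y Z e' => hM.2 Y Z (e ≪≫ e')⟩

/-- Splitting both `e` and `𝟙 M - e` writes `M` as the biproduct of their images, one of which must
vanish. -/
theorem CategoryTheory.Indecomposable.eq_zero_or_eq_id [HasBinaryBiproducts C]
    [IsIdempotentComplete C] {M : C} (hM : Indecomposable M) {e : M ⟶ M} (he : e ≫ e = e) :
    e = 0 ∨ e = 𝟙 M := by
  obtain ⟨Y, i, p, hip, hpi⟩ := IsIdempotentComplete.idempotents_split M e he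
  obtain ⟨Z, i', p', hip', hpi'⟩ := IsIdempotentComplete.idempotents_split M (𝟙 M - e)
    (Idempotents.idem_of_id_sub_idem e he)
  have h1 : i ≫ p' = 0 := by
    calc i ≫ p' = (i ≫ p) ≫ i ≫ p' ≫ i' ≫ p' := by rw [hip, hip']; simp
      _ = i ≫ (p ≫ i) ≫ (p' ≫ i') ≫ p' := by simp only [Category.assoc]
      _ = 0 := by
        rw [hpi, hpi', ← Category.assoc e]
        simp [Preadditive.comp_sub, he]
  have h2 : i' ≫ p = 0 := by
    calc i' ≫ p = (i' ≫ p') ≫ i' ≫ p ≫ i ≫ p := by rw [hip, hip']; simp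
      _ = i' ≫ (p' ≫ i') ≫ (p ≫ i) ≫ p := by simp only [Category.assoc]
      _ = 0 := by
        rw [hpi, hpi', ← Category.assoc (𝟙 M - e)]
        simp [Preadditive.sub_comp, he]
  let φ : M ≅ Y ⊞ Z :=
    { hom := biprod.lift p p'
      inv := biprod.desc i i'
      hom_inv_id := by rw [biprod.lift_desc, hpi, hpi', add_sub_cancel]
      inv_hom_id := by
        apply biprod.hom_ext' <;> apply biprod.hom_ext <;> simp [hip, hip', h1, h2] }
  rcases hM.2 Y Z φ with h | h
  · left
    rw [← hpi, h.eq_of_src i 0, comp_zero]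
  · right
    rw [h.eq_of_src i' 0, comp_zero, eq_comm, sub_eq_zero] at hpi'
    exact hpi'.symm

theorem CategoryTheory.End.isNilpotent_comp_swap {M N : C} {a : M ⟶ N} {b : N ⟶ M}
    (h : IsNilpotent (End.of (b ≫ a))) : IsNilpotent (End.of (a ≫ b)) := by
  obtain ⟨n, hn⟩ := h
  refine ⟨n + 1, ?_⟩
  rw [End.comp_pow_succ, hn]
  exact (congrArg (a ≫ ·) zero_comp).trans comp_zero

variable (k : Type u) [Field k] [Linear k C]

/-- If all nonzero endomorphisms of `M` are invertible, then `dim End M` divides `dim Hom(M, N)`. -/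
theorem finrank_end_dvd_finrank_hom {M : C} (hM : ∀ f : M ⟶ M, f ≠ 0 → IsIso f) (h0 : ¬ IsZero M)
    (N : C) : Module.finrank k (M ⟶ M) ∣ Module.finrank k (M ⟶ N) := by
  have : Nontrivial (End M) := ⟨𝟙 M, 0, fun h => h0 ((IsZero.iff_id_eq_zero M).2 h)⟩
  -- Precomposition makes `Hom(M, N)` a vector space over the division ring `(End M)ᵐᵒᵖ`; the tower
  -- law for dimensions gives the divisibility.
  let : DivisionRing (End M)ᵐᵒᵖ := DivisionRing.ofIsUnitOrEqZero fun a => by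
    by_cases h : a.unop = 0
    · right
      exact MulOpposite.unop_injective h
    · left
      exact ((isUnit_iff_isIso (show M ⟶ M from a.unop)).2 (hM _ h)).op
  have : IsScalarTower k (End M)ᵐᵒᵖ (M ⟶ N) := ⟨fun c f g => by
    exact Linear.smul_comp _ _ _ c f.unop g⟩
  have h := Module.finrank_mul_finrank k (End M)ᵐᵒᵖ (M ⟶ N)
  rw [← h, (MulOpposite.opLinearEquiv k (M := End M)).symm.finrank_eq]
  exact dvd_mul_right _ _

variable [∀ M N : C, Module.Finite k (M ⟶ N)]

include k in
theorem CategoryTheory.Indecomposable.isUnit_or_isNilpotent [HasBinaryBiproducts C]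
    [IsIdempotentComplete C] {M : C} (hM : Indecomposable M) (f : End M) :
    IsUnit f ∨ IsNilpotent f := by
  have : Module.Finite k (End M) := inferInstanceAs (Module.Finite k (M ⟶ M))
  exact isUnit_or_isNilpotent_of_forall_isIdempotentElem k (A := End M)
    (fun e he => hM.eq_zero_or_eq_id (e := (show M ⟶ M from e)) he) f

include k in
/-- A composite `M ⟶ N ⟶ M` of morphisms between indecomposable objects is nilpotent unless the
first one is an isomorphism. -/
theorem isNilpotent_comp_of_not_isIso [HasBinaryBiproducts C] [IsIdempotentComplete C] {M N : C}
    (hM : Indecomposable M) (hN : Indecomposable N) {x : M ⟶ N} (hx : ¬ IsIso x) (y : N ⟶ M) :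
    IsNilpotent (End.of (x ≫ y)) := by
  refine (hM.isUnit_or_isNilpotent k _).resolve_left fun h1 => ?_
  -- If `x ≫ y` and `y ≫ x` are both invertible, then `x` is split mono and split epi. If `y ≫ x` is
  -- nilpotent, then so is the unit `x ≫ y`, forcing `M = 0`.
  rcases hN.isUnit_or_isNilpotent k (End.of (y ≫ x)) with h2 | h2
  · have h1' : IsIso (x ≫ y) := (isUnit_iff_isIso (x ≫ y)).1 h1
    have h2' : IsIso (y ≫ x) := (isUnit_iff_isIso (y ≫ x)).1 h2
    have : IsSplitMono x := ⟨⟨⟨y ≫ inv (x ≫ y), by rw [← Category.assoc, IsIso.hom_inv_id]⟩⟩⟩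
    have : IsSplitEpi x := ⟨⟨⟨inv (y ≫ x) ≫ y, by rw [Category.assoc, IsIso.inv_hom_id]⟩⟩⟩
    have : Epi x := inferInstance
    exact hx (isIso_of_epi_of_isSplitMono x)
  · obtain ⟨n, hn⟩ := End.isNilpotent_comp_swap h2
    have h0 := h1.pow n
    rw [hn, isUnit_zero_iff] at h0
    exact hM.1 ((IsZero.iff_id_eq_zero M).2 h0.symm)

include k in
/-- A morphism between summands which is not an isomorphism lies in the Jacobson radical of the
endomorphism ring of the direct sum. -/
theorem mem_jacobson_end_of_not_isIso [HasBinaryBiproducts C] [IsIdempotentComplete C]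
    {ι : Type*} {T : ι → C} [HasBiproduct T] (hT : ∀ i, Indecomposable (T i)) {i j : ι}
    {x : T i ⟶ T j} (hx : ¬ IsIso x) :
    End.of (biproduct.π T i ≫ x ≫ biproduct.ι T j) ∈ Ring.jacobson (End (⨁ T)) := by
  refine Ring.mem_jacobson_of_forall_isNilpotent fun y => ?_
  -- A left multiple `π ≫ x ≫ ι ≫ y` is nilpotent once its rotation `x ≫ ι ≫ y ≫ π`, an endomorphism
  -- of the indecomposable `T i`, is.
  have h := isNilpotent_comp_of_not_isIso k (hT i) (hT j) hx
    (biproduct.ι T j ≫ y.asHom ≫ biproduct.π T i)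
  have h' := End.isNilpotent_comp_swap (a := biproduct.π T i) (b := x ≫ biproduct.ι T j ≫ y.asHom)
    (by simpa only [Category.assoc] using h)
  have e : y * End.of (biproduct.π T i ≫ x ≫ biproduct.ι T j) =
      End.of (biproduct.π T i ≫ x ≫ biproduct.ι T j ≫ y.asHom) := by
    simp [End.mul_def]
  rwa [e]

/-- The dimension of `Hom(M, ⨁ f)`. -/
theorem finrank_hom_biproduct {ι : Type*} [Fintype ι] (M : C) (f : ι → C) [HasBiproduct f] :
    Module.finrank k (M ⟶ ⨁ f) = ∑ i, Module.finrank k (M ⟶ f i) := by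
  let e : (M ⟶ ⨁ f) ≃ₗ[k] (∀ i, M ⟶ f i) :=
    { toFun := fun g i => g ≫ biproduct.π f i
      map_add' := fun _ _ => by ext; simp
      map_smul' := fun _ _ => by ext; simp
      invFun := fun g => biproduct.lift g
      left_inv := fun g => by ext; simp
      right_inv := fun g => by ext; simp }
  rw [e.finrank_eq, Module.finrank_pi_fintype]

theorem finrank_end_pos {M : C} (h0 : ¬ IsZero M) : 0 < Module.finrank k (M ⟶ M) := by
  have : Nontrivial (M ⟶ M) := ⟨𝟙 M, 0, fun h => h0 ((IsZero.iff_id_eq_zero M).2 h)⟩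
  exact Module.finrank_pos

/-- Makes `dim End` drop strictly when a nonzero complement is split off, so that it can serve as
the induction measure for decompositions. -/
theorem finrank_end_add_le [HasBinaryBiproducts C] (M N : C) :
    Module.finrank k (M ⟶ M) + Module.finrank k (N ⟶ N) ≤ Module.finrank k (M ⊞ N ⟶ M ⊞ N) := by
  rw [← Module.finrank_prod]
  refine LinearMap.finrank_le_finrank_of_injective
    (f := ({ toFun := fun g => biprod.map g.1 g.2
             map_add' := fun _ _ => by ext <;> simp
             map_smul' := fun _ _ => by ext <;> simp } :
           ((M ⟶ M) × (N ⟶ N)) →ₗ[k] (M ⊞ N ⟶ M ⊞ N))) ?_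
  rintro ⟨a, b⟩ ⟨a', b'⟩ h
  have h : biprod.map a b = biprod.map a' b' := h
  have h1 := congrArg (fun t => biprod.inl ≫ t ≫ biprod.fst) h
  have h2 := congrArg (fun t => biprod.inr ≫ t ≫ biprod.snd) h
  simp only [biprod.map_fst, biprod.map_snd, biprod.inl_fst_assoc, biprod.inr_snd_assoc] at h1 h2
  rw [h1, h2]

/-- The biproduct over a disjoint union. -/
def biproductSumIso [HasFiniteBiproducts C] [HasBinaryBiproducts C] {ι κ : Type*} [Finite ι]
    [Finite κ] (F : ι ⊕ κ → C) :
    (⨁ fun i => F (Sum.inl i)) ⊞ (⨁ fun i => F (Sum.inr i)) ≅ ⨁ F where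
  hom := biprod.desc (biproduct.desc fun i => biproduct.ι F (Sum.inl i))
    (biproduct.desc fun i => biproduct.ι F (Sum.inr i))
  inv := biproduct.desc fun t => match t with
    | Sum.inl i => biproduct.ι (fun i => F (Sum.inl i)) i ≫ biprod.inl
    | Sum.inr i => biproduct.ι (fun i => F (Sum.inr i)) i ≫ biprod.inr
  hom_inv_id := by
    apply biprod.hom_ext' <;> apply biproduct.hom_ext' <;> intro j <;> simp
  inv_hom_id := by
    apply biproduct.hom_ext'
    rintro (j | j) <;> simp

include k in
/-- Each object of a Hom-finite category is a finite direct sum of indecomposable ones. -/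
theorem exists_iso_biproduct_indecomposable [HasFiniteBiproducts C] [HasBinaryBiproducts C] (M : C) :
    ∃ (ι : Type) (_ : Fintype ι) (f : ι → C), (∀ i, Indecomposable (f i)) ∧
      Nonempty (M ≅ ⨁ f) := by
  induction h : Module.finrank k (M ⟶ M) using Nat.strong_induction_on generalizing M with
  | _ n ih =>
    subst h
    by_cases h0 : IsZero M
    · refine ⟨PEmpty, inferInstance, PEmpty.elim, fun i => i.elim, ⟨h0.iso ?_⟩⟩
      rw [IsZero.iff_id_eq_zero]
      apply biproduct.hom_ext
      rintro ⟨⟩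
    · by_cases hM : Indecomposable M
      · exact ⟨Unit, inferInstance, fun _ => M, fun _ => hM,
          ⟨(biproductUniqueIso fun _ : Unit => M).symm⟩⟩
      · have : ∃ Y Z : C, ∃ _ : M ≅ Y ⊞ Z, ¬ IsZero Y ∧ ¬ IsZero Z := by
          by_contra hcon
          push Not at hcon
          exact hM ⟨h0, fun Y Z e => or_iff_not_imp_left.2 (hcon Y Z e)⟩
        obtain ⟨Y, Z, e, hY, hZ⟩ := this
        have h1 := finrank_end_add_le k Y Z
        have h2 := finrank_end_pos k hY
        have h3 := finrank_end_pos k hZ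
        have h4 := LinearEquiv.finrank_eq (Linear.homCongr k e e)
        obtain ⟨ι, _, f, hf, ⟨eY⟩⟩ := ih _ (by omega) Y rfl
        obtain ⟨κ, _, g, hg, ⟨eZ⟩⟩ := ih _ (by omega) Z rfl
        exact ⟨ι ⊕ κ, inferInstance, Sum.elim f g, Sum.rec hf hg,
          ⟨e ≪≫ biprod.mapIso eY eZ ≪≫ biproductSumIso (Sum.elim f g)⟩⟩

end KrullSchmidt

/-! ### Directedness of a family of modules with acyclic Gabriel quiver -/

section Directed

/-- Targets of paths count as smaller than their sources, matching the direction in which row `i` of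
the Hom matrix involves `j`. -/
theorem HasNoOrientedCycle.wellFounded {Q : Type v} [Quiver.{w} Q] [Finite Q]
    (hQ : HasNoOrientedCycle Q) :
    WellFounded fun j i : Q => ∃ p : Quiver.Path i j, p.length ≠ 0 := by
  have : IsTrans Q fun j i : Q => ∃ p : Quiver.Path i j, p.length ≠ 0 :=
    ⟨fun a b c ⟨p, hp⟩ ⟨q, _⟩ => ⟨q.comp p, by rw [Quiver.Path.length_comp]; omega⟩⟩
  have : Std.Irrefl fun j i : Q => ∃ p : Quiver.Path i j, p.length ≠ 0 :=
    ⟨fun a ⟨p, hp⟩ => hp (hQ a p)⟩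
  exact Finite.wellFounded_of_trans_of_irrefl _

variable (k : Type u) [Field k] {C : Type v} [Category.{w} C] [Preadditive C] [Linear k C]
  [∀ M N : C, Module.Finite k (M ⟶ N)] [HasBinaryBiproducts C] [IsIdempotentComplete C]
  {ι : Type*} [Finite ι] {T : ι → C} [HasBiproduct T]

/-- A non-isomorphism `x`, viewed in `End (⨁ T)`, is radical and lies in the `(i, j)` corner.
Without a nontrivial path that corner of the radical is zero. -/
theorem exists_path_of_not_isIso (hT : ∀ i, Indecomposable (T i)) {i j : ι}
    {x : T i ⟶ T j} (hx : ¬ IsIso x) (h0 : x ≠ 0) :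
    ∃ p : Quiver.Path (V := GabrielQuiver k (summandIdempotent T)) i j, p.length ≠ 0 := by
  have := Fintype.ofFinite ι
  have : Module.Finite k (End (⨁ T)) := inferInstanceAs (Module.Finite k (⨁ T ⟶ ⨁ T))
  by_contra! hp
  have h1 : ∑ i, summandIdempotent T i = 1 := by
    change ∑ i, biproduct.π T i ≫ biproduct.ι T i = 𝟙 (⨁ T)
    refine biproduct.hom_ext' _ _ fun j => ?_
    rw [Preadditive.comp_sum, Finset.sum_eq_single j (fun i _ hi => ?_) (by simp),
      biproduct.ι_π_self_assoc, Category.comp_id]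
    rw [biproduct.ι_π_ne_assoc T hi.symm, zero_comp]
  have h2 : ∀ i, summandIdempotent T i * summandIdempotent T i = summandIdempotent T i := by
    intro i
    simp [summandIdempotent, End.mul_def]
  have h3 := mul_mul_eq_zero_of_forall_path h1 h2 hp (mem_jacobson_end_of_not_isIso k hT hx)
  have h4 : ((biproduct.π T i ≫ biproduct.ι T i) ≫ biproduct.π T i ≫ x ≫ biproduct.ι T j) ≫
      biproduct.π T j ≫ biproduct.ι T j = 0 := h3
  apply h0
  have h5 := congrArg (fun t => biproduct.ι T i ≫ t ≫ biproduct.π T j) h4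
  simpa using h5

/-- If the Gabriel quiver of `End (⨁ T)` is acyclic, then nonzero morphisms between different
members of `T` follow a well-founded relation, and the members of `T` are bricks. -/
theorem exists_wellFounded_of_hasNoOrientedCycle (hT : ∀ i, Indecomposable (T i))
    (hiso : ∀ i j, Nonempty (T i ≅ T j) → i = j)
    (h : HasNoOrientedCycle (GabrielQuiver k (summandIdempotent T))) :
    ∃ s : ι → ι → Prop, WellFounded s ∧
      (∀ i j, i ≠ j → Module.finrank k (T i ⟶ T j) ≠ 0 → s j i) ∧
      ∀ i (f : T i ⟶ T i), f ≠ 0 → IsIso f := by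
  have : Finite (GabrielQuiver k (summandIdempotent T)) := inferInstanceAs (Finite ι)
  refine ⟨_, h.wellFounded, fun i j hij hfin => ?_, fun i f hf => ?_⟩
  · have : Nontrivial (T i ⟶ T j) := by
      by_contra hn
      rw [not_nontrivial_iff_subsingleton] at hn
      exact hfin Module.finrank_zero_of_subsingleton
    obtain ⟨x, hx⟩ := exists_ne (0 : T i ⟶ T j)
    exact exists_path_of_not_isIso k hT (fun hx' => hij (hiso i j ⟨asIso x⟩)) hx
  · by_contra hn
    obtain ⟨p, hp⟩ := exists_path_of_not_isIso k hT hn hf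
    exact hp (h i p)

end Directed

/-! ### Left Kan extension along an order-embedding -/

section Kan

variable (k : Type u) [Field k] {X : Type v} {P : Type w} [PartialOrder X] [PartialOrder P]

instance (f : X ↪o P) : f.monotone.functor.Full where
  map_surjective h := ⟨homOfLE (f.le_iff_le.1 (leOfHom h)), Subsingleton.elim _ _⟩

instance (f : X ↪o P) : f.monotone.functor.Faithful where
  map_injective _ := Subsingleton.elim _ _

variable [Finite X]

/-- Since an order-embedding `f` is full, `f^* f_! U ≅ U`. -/
def shriekRestrictIso (f : X ↪o P) (U : PosetMod k X) :
    U ≅ (restrict k f).obj ((shriek k f).obj U) :=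
  @asIso _ _ _ _ ((shriekAdjunction k f).unit.app U)
    (inferInstanceAs (IsIso ((f.monotone.functor.lanAdjunction (FGModuleCat.{u} k)).unit.app U)))

/-- `Hom(f_! U, M) ≅ Hom(U, f^* M)`. -/
def shriekHomLinearEquiv (f : X ↪o P) (U : PosetMod k X) (M : PosetMod k P) :
    ((shriek k f).obj U ⟶ M) ≃ₗ[k] (U ⟶ (restrict k f).obj M) :=
  { (shriekAdjunction k f).homEquiv U M with
    map_add' := fun a b => by
      have h : ∀ c, (shriekAdjunction k f).homEquiv U M c = _ :=
        fun c => (shriekAdjunction k f).homEquiv_unit U M c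
      exact (h (a + b)).trans ((Preadditive.comp_add _ _ _ _ _ _).trans
        (congrArg₂ (· + ·) (h a).symm (h b).symm))
    map_smul' := fun c a => by
      have h : ∀ c, (shriekAdjunction k f).homEquiv U M c = _ :=
        fun c => (shriekAdjunction k f).homEquiv_unit U M c
      exact (h (c • a)).trans ((Linear.comp_smul _ _ _ _ _ _).trans
        (congrArg (c • ·) (h a).symm)) }

/-- A splitting of `f_! U` restricts to one of `f^* f_! U ≅ U`, so one summand `Y` has `f^* Y = 0`.
Then `Hom(f_! U, Y) ≅ Hom(U, f^* Y) = 0` kills the projection onto `Y`, hence `Y` itself. -/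
theorem indecomposable_shriek (f : X ↪o P) {U : PosetMod k X} (hU : Indecomposable U) :
    Indecomposable ((shriek k f).obj U) := by
  have : (restrict k f).Additive := ⟨rfl⟩
  have := preservesBinaryBiproducts_of_preservesBiproducts (restrict k f)
  let e := shriekRestrictIso k f U
  have key : ∀ (Y : PosetMod k P) (i : Y ⟶ (shriek k f).obj U) (p : (shriek k f).obj U ⟶ Y),
      i ≫ p = 𝟙 Y → IsZero ((restrict k f).obj Y) → IsZero Y := by
    intro Y i p hip hY
    rw [IsZero.iff_id_eq_zero, ← hip]
    have : p = 0 := (shriekHomLinearEquiv k f U Y).injective (hY.eq_of_tgt _ _)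
    rw [this, comp_zero]
  refine ⟨fun h => hU.1 (((restrict k f).map_isZero h).of_iso e), fun Y Z φ => ?_⟩
  rcases hU.2 _ _ (e ≪≫ (restrict k f).mapIso φ ≪≫ (restrict k f).mapBiprod Y Z) with h | h
  · exact Or.inl (key Y (biprod.inl ≫ φ.inv) (φ.hom ≫ biprod.fst) (by simp) h)
  · exact Or.inr (key Z (biprod.inr ≫ φ.inv) (φ.hom ≫ biprod.snd) (by simp) h)

end Kan

/-! ### Bases of invariants -/

section Basis

variable {C : Type v} [Category.{w} C] [Preadditive C] [HasBinaryBiproducts C]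

theorem SplitK0.induction_on {p : SplitK0 C → Prop} (z : SplitK0 C)
    (of : ∀ M : C, p (SplitK0.of (isoClass M))) (zero : p 0) (neg : ∀ a, p a → p (-a))
    (add : ∀ a b, p a → p b → p (a + b)) : p z := by
  induction z using QuotientAddGroup.induction_on with
  | H z =>
    induction z using FreeAbelianGroup.induction_on with
    | zero => exact zero
    | of c =>
      induction c using Quotient.inductionOn with
      | h M => exact of M
    | neg c h => exact neg _ h
    | add a b ha hb => exact add _ _ ha hb

theorem exists_sum_of_mem_spanClasses {Q : Type*} [Fintype Q] {T : Q → IsoClass C} {z : SplitK0 C}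
    (hz : z ∈ spanClasses (Set.range T)) : ∃ n : Q → ℤ, z = ∑ q, n q • SplitK0.of (T q) := by
  classical
  induction hz using AddSubgroup.closure_induction with
  | mem x hx =>
    obtain ⟨_, ⟨q, rfl⟩, rfl⟩ := hx
    exact ⟨Pi.single q 1, by simp [Pi.single_apply]⟩
  | zero => exact ⟨0, by simp⟩
  | add x y _ _ hx hy =>
    obtain ⟨n, rfl⟩ := hx
    obtain ⟨m, rfl⟩ := hy
    exact ⟨n + m, by simp [add_zsmul, Finset.sum_add_distrib]⟩
  | neg x _ hx =>
    obtain ⟨n, rfl⟩ := hx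
    exact ⟨-n, by simp⟩

theorem sum_mem_spanClasses {Q : Type*} [Fintype Q] (T : Q → IsoClass C) (n : Q → ℤ) :
    ∑ q, n q • SplitK0.of (T q) ∈ spanClasses (Set.range T) :=
  sum_mem fun q _ => zsmul_mem (AddSubgroup.subset_closure
    (Set.mem_image_of_mem _ (Set.mem_range_self q))) _

/-- Both conditions see `Ψ` only through its kernel, which allows the transfer from `dimh` to
`mult`. -/
theorem isInvariantBasis_of_forall {N : Type*} [Finite N] {Ψ : SplitK0 C →+ (N → ℤ)}
    {B : Set (IsoClass C)} (hB : ∀ c ∈ B, Indecomposable c.out)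
    (hinj : ∀ z ∈ spanClasses B, Ψ z = 0 → z = 0)
    (hsurj : ∀ z, ∃ s ∈ spanClasses B, Ψ (s - z) = 0) : IsInvariantBasis Ψ B where
  finite_invariant := by
    rw [← AddSubgroup.toIntSubmodule.symm_apply_apply Ψ.range]
    exact (Submodule.fg_iff_addSubgroup_fg _).1 (IsNoetherian.noetherian _)
  indecomposable := hB
  bijective := by
    constructor
    · rw [injective_iff_map_eq_zero]
      rintro ⟨z, hz⟩ h
      exact Subtype.ext (hinj z hz (congrArg Subtype.val h))
    · rintro ⟨_, z, rfl⟩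
      obtain ⟨s, hs, h⟩ := hsurj z
      rw [map_sub, sub_eq_zero] at h
      exact ⟨⟨s, hs⟩, Subtype.ext h⟩

end Basis

/-! ### Decompositions into indecomposable modules and their multiplicities -/

section Decomposition

variable {k : Type u} [Field k] {X : Type v} [PartialOrder X]

theorem IndecClass.indecomposable_rep (U : IndecClass k X) : Indecomposable U.rep := U.2

theorem isoClass_out_iso {C : Type v} [Category.{w} C] (M : C) :
    Nonempty ((isoClass M).out ≅ M) :=
  Quotient.mk_out (s := isIsomorphicSetoid C) M

/-- The class in `Ind X` of an indecomposable module. -/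
def IndecClass.mk {M : PosetMod k X} (hM : Indecomposable M) : IndecClass k X :=
  ⟨isoClass M, hM.of_iso (isoClass_out_iso M).some.symm⟩

theorem IndecClass.eq_of_iso {U V : IndecClass k X} (h : Nonempty (U.rep ≅ V.rep)) : U = V :=
  Subtype.ext (Quotient.out_equiv_out.1 h)

/-- The summands are grouped by isomorphism class, with `α U` the size of the fibre. Uniqueness is
not needed here: Hom dimensions supply what is required in `multFun_isAdditiveInvariant`. -/
theorem exists_isDecomposition [Finite X] (M : PosetMod k X) : ∃ α, IsDecomposition M α := by
  classical
  obtain ⟨ι, _, f, hf, ⟨e⟩⟩ := exists_iso_biproduct_indecomposable k M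
  let c : ι → IndecClass k X := fun i => IndecClass.mk (hf i)
  let α : IndecClass k X →₀ ℕ :=
    Finsupp.onFinset (Finset.univ.image c) (fun U => Fintype.card {i // c i = U}) fun U hU => by
      obtain ⟨⟨i, hi⟩⟩ := Fintype.card_pos_iff.1 (Nat.pos_of_ne_zero hU)
      exact Finset.mem_image.2 ⟨i, Finset.mem_univ _, hi⟩
  have hα : ∀ i, c i ∈ α.support := fun i => by
    rw [Finsupp.mem_support_iff]
    exact (Fintype.card_pos_iff.2 ⟨⟨i, rfl⟩⟩).ne'
  let c' : ι → α.support := fun i => ⟨c i, hα i⟩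
  let φ : ((U : α.support) × Fin (α U)) ≃ ι :=
    (Equiv.sigmaCongrRight fun U : α.support =>
      ((Fintype.equivFinOfCardEq (n := α U) rfl).symm.trans
        (Equiv.subtypeEquivRight fun i => (Subtype.ext_iff (a1 := c' i) (a2 := U)).symm :
          {i // c i = U.1} ≃ {i // c' i = U}))).trans (Equiv.sigmaFiberEquiv c')
  have hφ : ∀ x, c (φ x) = x.1.1 := fun x => congrArg Subtype.val
    (Equiv.subtypeEquivRight (fun i => (Subtype.ext_iff (a1 := c' i) (a2 := x.1)).symm)
      ((Fintype.equivFinOfCardEq (n := α x.1) rfl).symm x.2)).2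
  refine ⟨α, ⟨e ≪≫ (biproduct.whiskerEquiv φ fun x => ?_).symm⟩⟩
  refine (isoClass_out_iso (f (φ x))).some.symm ≪≫ eqToIso ?_
  exact congrArg IndecClass.rep (hφ x)

theorem IsDecomposition.finrank_hom [Finite X] [Fintype (IndecClass k X)] {M : PosetMod k X}
    {α : IndecClass k X →₀ ℕ} (h : IsDecomposition M α) (U : PosetMod k X) :
    Module.finrank k (U ⟶ M) = ∑ V, Module.finrank k (U ⟶ V.rep) * α V := by
  obtain ⟨e⟩ := h
  rw [LinearEquiv.finrank_eq (Linear.homCongr k (Iso.refl U) e), finrank_hom_biproduct,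
    Fintype.sum_sigma]
  have h1 : ∀ V : α.support, ∑ _j : Fin (α V), Module.finrank k (U ⟶ V.1.rep) =
      α V * Module.finrank k (U ⟶ V.1.rep) := fun V => by
    rw [Finset.sum_const, Finset.card_univ, Fintype.card_fin, smul_eq_mul]
  refine (Finset.sum_congr rfl fun V _ => h1 V).trans ?_
  rw [Finset.sum_coe_sort α.support (fun V => α V * Module.finrank k (U ⟶ V.rep))]
  refine (Finset.sum_subset (Finset.subset_univ _) fun V _ hV => ?_).trans
    (Finset.sum_congr rfl fun V _ => mul_comm _ _)
  rw [Finsupp.notMem_support_iff.1 hV, zero_mul]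

theorem isDecomposition_decompMult [Finite X] (M : PosetMod k X) :
    IsDecomposition M (decompMult M) := by
  have h := exists_isDecomposition M
  rw [decompMult, dif_pos h]
  exact h.choose_spec

end Decomposition

/-! ### The invariants `dimh` and `mult` -/

section Main

variable (k : Type u) [Field k] {X : Type v} {P : Type w} [PartialOrder X] [PartialOrder P]
  [Finite X] (E : Set (Emb X P))

theorem indecomposable_shriekRep (q : ShriekIndex k E) : Indecomposable (shriekRep k E q) :=
  indecomposable_shriek k _ (IndecClass.indecomposable_rep _)

theorem shriekRep_injective {q q' : ShriekIndex k E}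
    (h : Nonempty (shriekRep k E q ≅ shriekRep k E q')) : q = q' :=
  Quotient.out_equiv_out.1 (show (shriekSetoid k E) q.out q'.out from h)

/-- The chosen representative of the class of `(f, U)` is isomorphic to `f_! U`. -/
theorem nonempty_shriekRep_mk_iso (i : E × IndecClass k X) :
    Nonempty (shriekRep k E (Quotient.mk _ i) ≅ shriekObj k E i) :=
  Quotient.mk_out (s := shriekSetoid k E) i

/-- For `f ∈ E`, the map `U ↦ [(f, U)]` is injective. -/
theorem shriekIndex_mk_injective (f : E) :
    Function.Injective fun U : IndecClass k X => (Quotient.mk _ (f, U) : ShriekIndex k E) := by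
  intro U V h
  obtain ⟨e⟩ : Nonempty (shriekObj k E (f, U) ≅ shriekObj k E (f, V)) :=
    (Quotient.exact h : (shriekSetoid k E) (f, U) (f, V))
  exact IndecClass.eq_of_iso ⟨shriekRestrictIso k f.1.rep U.rep ≪≫
    (restrict k f.1.rep).mapIso e ≪≫ (shriekRestrictIso k f.1.rep V.rep).symm⟩

/-- The adjunction; in particular the coordinate depends only on the `∼_!`-class of `i`. -/
theorem dimhFun_eq_finrank (M : PosetMod k P) (i : E × IndecClass k X) :
    dimhFun k E M i = Module.finrank k (shriekRep k E (Quotient.mk _ i) ⟶ M) := by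
  rw [LinearEquiv.finrank_eq (Linear.homCongr k (nonempty_shriekRep_mk_iso k E i).some
    (Iso.refl M))]
  exact congrArg Nat.cast (shriekHomLinearEquiv k i.1.1.rep i.2.rep M).finrank_eq.symm

theorem dimh_of (M : PosetMod k P) : dimh k E (SplitK0.of (isoClass M)) = dimhFun k E M :=
  (dimhFun_isAdditiveInvariant k E).toHom_of M

/-- Left Kan extension along `f` is fully faithful, so the Hom matrix of `Ind X` sits inside that of
the modules `f_! U`. -/
theorem finrank_shriekRep_mk_hom (f : E) (U V : IndecClass k X) :
    Module.finrank k (shriekRep k E (Quotient.mk _ (f, U)) ⟶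
      shriekRep k E (Quotient.mk _ (f, V))) = Module.finrank k (U.rep ⟶ V.rep) := by
  rw [LinearEquiv.finrank_eq (Linear.homCongr k (nonempty_shriekRep_mk_iso k E (f, U)).some
    (nonempty_shriekRep_mk_iso k E (f, V)).some)]
  refine (shriekHomLinearEquiv k f.1.rep U.rep _).finrank_eq.trans ?_
  exact LinearEquiv.finrank_eq
    (Linear.homCongr k (Iso.refl U.rep) (shriekRestrictIso k f.1.rep V.rep).symm)

theorem dimhFun_eq_sum_multFun [Fintype (IndecClass k X)] (M : PosetMod k P) (f : E)
    (U : IndecClass k X) : dimhFun k E M (f, U) =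
      ∑ V, (Module.finrank k (U.rep ⟶ V.rep) : ℤ) * multFun k E M (f, V) := by
  have h := (isDecomposition_decompMult ((restrict k f.1.rep).obj M)).finrank_hom U.rep
  rw [dimhFun, h]
  push_cast
  rfl

theorem dimh_eq_sum_mult [Fintype (IndecClass k X)] (h : IsAdditiveInvariant (multFun k E))
    (z : SplitK0 (PosetMod k P)) (f : E) (U : IndecClass k X) : dimh k E z (f, U) =
      ∑ V, (Module.finrank k (U.rep ⟶ V.rep) : ℤ) * h.toHom z (f, V) := by
  induction z using SplitK0.induction_on with
  | of M => rw [dimh_of, h.toHom_of, dimhFun_eq_sum_multFun]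
  | zero => simp
  | neg a ha => simp [ha]
  | add a b ha hb => simp [ha, hb, mul_add, Finset.sum_add_distrib]

theorem dimh_sum [Fintype (ShriekIndex k E)] (n : ShriekIndex k E → ℤ)
    (i : E × IndecClass k X) :
    dimh k E (∑ q, n q • SplitK0.of (isoClass (shriekRep k E q))) i =
      ∑ q, (Module.finrank k (shriekRep k E (Quotient.mk _ i) ⟶ shriekRep k E q) : ℤ) * n q := by
  rw [map_sum, Finset.sum_apply]
  refine Finset.sum_congr rfl fun q _ => ?_
  rw [map_zsmul, Pi.smul_apply, dimh_of, dimhFun_eq_finrank, smul_eq_mul, mul_comm]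

theorem indecomposable_of_mem_shriekClasses :
    ∀ c ∈ shriekClasses k E, Indecomposable c.out := by
  rintro _ ⟨q, rfl⟩
  exact (indecomposable_shriekRep k E q).of_iso (isoClass_out_iso _).some.symm

variable [IsRepFinite k X] [Finite P]

/-- Pulling the well-founded relation back along `U ↦ [(f, U)]` makes the Hom matrix of `Ind X`
triangular. -/
theorem eq_zero_of_sum_finrank_hom_mul_eq_zero [Fintype (IndecClass k X)]
    (hacyclic : HasNoOrientedCycle (ShriekGabrielQuiver k E)) (f : E) {n : IndecClass k X → ℤ}
    (hn : ∀ U : IndecClass k X, ∑ V, (Module.finrank k (U.rep ⟶ V.rep) : ℤ) * n V = 0) : n = 0 := by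
  obtain ⟨s, hs, hh, -⟩ := exists_wellFounded_of_hasNoOrientedCycle k
    (indecomposable_shriekRep k E) (fun _ _ => shriekRep_injective k E) hacyclic
  refine eq_zero_of_triangular (InvImage.wf (fun U : IndecClass k X =>
    (Quotient.mk _ (f, U) : ShriekIndex k E)) hs) (fun U V hUV h0 => ?_) (fun U => ?_) hn
  · refine hh _ _ (fun h => hUV (shriekIndex_mk_injective k E f h)) ?_
    rw [finrank_shriekRep_mk_hom]
    exact_mod_cast h0
  · exact_mod_cast (finrank_end_pos k U.indecomposable_rep.1).ne'

/-- The Hom dimensions into `f^* M` determine the chosen multiplicities by the injectivity of the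
Hom matrix, so these inherit invariance and additivity from `dimh`, with no appeal to Krull–Schmidt
uniqueness. -/
theorem multFun_isAdditiveInvariant (hacyclic : HasNoOrientedCycle (ShriekGabrielQuiver k E)) :
    IsAdditiveInvariant (multFun k E) := by
  have := Fintype.ofFinite (IndecClass k X)
  have hd := dimhFun_isAdditiveInvariant k E
  constructor
  · intro M M' e
    funext ⟨f, U⟩
    refine congrFun (sub_eq_zero.1 (eq_zero_of_sum_finrank_hom_mul_eq_zero k E hacyclic f
      (n := (fun V => multFun k E M (f, V)) - fun V => multFun k E M' (f, V)) fun U => ?_)) U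
    simp only [Pi.sub_apply, mul_sub, Finset.sum_sub_distrib]
    rw [← dimhFun_eq_sum_multFun, ← dimhFun_eq_sum_multFun, hd.map_iso M M' e, sub_self]
  · intro M M'
    funext ⟨f, U⟩
    refine congrFun (sub_eq_zero.1 (eq_zero_of_sum_finrank_hom_mul_eq_zero k E hacyclic f
      (n := (fun V => multFun k E (M ⊞ M') (f, V)) -
        ((fun V => multFun k E M (f, V)) + fun V => multFun k E M' (f, V))) fun U => ?_)) U
    simp only [Pi.sub_apply, Pi.add_apply, mul_sub, mul_add, Finset.sum_sub_distrib,
      Finset.sum_add_distrib]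
    rw [← dimhFun_eq_sum_multFun, ← dimhFun_eq_sum_multFun, ← dimhFun_eq_sum_multFun,
      hd.map_biprod, Pi.add_apply, sub_self]

theorem mult_eq_zero_iff (hacyclic : HasNoOrientedCycle (ShriekGabrielQuiver k E))
    (h : IsAdditiveInvariant (multFun k E)) (z : SplitK0 (PosetMod k P)) :
    h.toHom z = 0 ↔ dimh k E z = 0 := by
  have := Fintype.ofFinite (IndecClass k X)
  constructor
  · intro hz
    funext ⟨f, U⟩
    simp [dimh_eq_sum_mult k E h, hz]
  · intro hz
    funext ⟨f, U⟩
    refine congrFun (eq_zero_of_sum_finrank_hom_mul_eq_zero k E hacyclic f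
      (n := fun V => h.toHom z (f, V)) fun U => ?_) U
    rw [← dimh_eq_sum_mult k E h, hz, Pi.zero_apply]

theorem eq_zero_of_mem_spanClasses (hacyclic : HasNoOrientedCycle (ShriekGabrielQuiver k E))
    {z : SplitK0 (PosetMod k P)} (hz : z ∈ spanClasses (shriekClasses k E))
    (h0 : dimh k E z = 0) : z = 0 := by
  have := Fintype.ofFinite (ShriekIndex k E)
  obtain ⟨n, rfl⟩ := exists_sum_of_mem_spanClasses hz
  obtain ⟨s, hs, hh, -⟩ := exists_wellFounded_of_hasNoOrientedCycle k
    (indecomposable_shriekRep k E) (fun _ _ => shriekRep_injective k E) hacyclic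
  have hn : n = 0 := by
    refine eq_zero_of_triangular hs (h := fun q q' =>
      (Module.finrank k (shriekRep k E q ⟶ shriekRep k E q') : ℤ))
      (fun q q' hq h0 => hh q q' hq (by exact_mod_cast h0))
      (fun q => by exact_mod_cast (finrank_end_pos k (indecomposable_shriekRep k E q).1).ne') ?_
    intro q
    -- Every row of the matrix is a coordinate of `dimh`, since every `q` is the class of some `(f,
    -- U)`.
    induction q using Quotient.inductionOn with
    | h i => rw [← dimh_sum, h0, Pi.zero_apply]
  simp [hn]

theorem exists_mem_spanClasses_dimh_eq (hacyclic : HasNoOrientedCycle (ShriekGabrielQuiver k E))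
    (z : SplitK0 (PosetMod k P)) :
    ∃ s ∈ spanClasses (shriekClasses k E), dimh k E (s - z) = 0 := by
  have := Fintype.ofFinite (ShriekIndex k E)
  induction z using SplitK0.induction_on with
  | of M =>
    obtain ⟨s, hs, hh, hb⟩ := exists_wellFounded_of_hasNoOrientedCycle k
      (indecomposable_shriekRep k E) (fun _ _ => shriekRep_injective k E) hacyclic
    -- The brick property enters here, making the triangular system solvable over `ℤ` and not just
    -- over `ℚ`.
    have hdvd : ∀ q N, Module.finrank k (shriekRep k E q ⟶ shriekRep k E q) ∣
        Module.finrank k (shriekRep k E q ⟶ N) := fun q N =>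
      finrank_end_dvd_finrank_hom k (hb q) (indecomposable_shriekRep k E q).1 N
    obtain ⟨n, hn⟩ := exists_solution_of_triangular hs (h := fun q q' =>
      (Module.finrank k (shriekRep k E q ⟶ shriekRep k E q') : ℤ))
      (v := fun q => (Module.finrank k (shriekRep k E q ⟶ M) : ℤ))
      (fun q q' hq h0 => hh q q' hq (by exact_mod_cast h0))
      (fun q q' => by exact_mod_cast hdvd q _) (fun q => by exact_mod_cast hdvd q M)
    refine ⟨_, sum_mem_spanClasses (fun q => isoClass (shriekRep k E q)) n, ?_⟩
    funext i
    rw [map_sub, Pi.sub_apply, dimh_sum, hn, dimh_of, dimhFun_eq_finrank, sub_self, Pi.zero_apply]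
  | zero => exact ⟨0, zero_mem _, by simp⟩
  | neg a ha =>
    obtain ⟨s, hs, h⟩ := ha
    exact ⟨-s, neg_mem hs, by rw [neg_sub_neg, ← neg_sub, map_neg, h, neg_zero]⟩
  | add a b ha hb =>
    obtain ⟨s, hs, h⟩ := ha
    obtain ⟨t, ht, h'⟩ := hb
    exact ⟨s + t, add_mem hs ht, by rw [add_sub_add_comm, map_add, h, h', add_zero]⟩

end Main

end

theorem mainTheorem6 (k : Type u) [Field k] (X : Type v) (P : Type w)
    [PartialOrder X] [Finite X] [PartialOrder P] [Finite P] [IsRepFinite k X]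
    (E : Set (Emb X P))
    (hcover : ⋃ f ∈ E, Set.range f.rep = Set.univ)
    (hacyclic : HasNoOrientedCycle (ShriekGabrielQuiver k E)) :
    IsInvariantBasis (dimh k E) (shriekClasses k E) ∧
    ∃ h : IsAdditiveInvariant (multFun k E),
      IsInvariantBasis h.toHom (shriekClasses k E) := by
  have hmult := multFun_isAdditiveInvariant k E hacyclic
  refine ⟨isInvariantBasis_of_forall (indecomposable_of_mem_shriekClasses k E)
    (fun z hz h0 => eq_zero_of_mem_spanClasses k E hacyclic hz h0)
    (exists_mem_spanClasses_dimh_eq k E hacyclic), hmult,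
    isInvariantBasis_of_forall (indecomposable_of_mem_shriekClasses k E) (fun z hz h0 => ?_)
    (fun z => ?_)⟩
  · exact eq_zero_of_mem_spanClasses k E hacyclic hz
      ((mult_eq_zero_iff k E hacyclic hmult z).1 h0)
  · obtain ⟨s, hs, h⟩ := exists_mem_spanClasses_dimh_eq k E hacyclic z
    exact ⟨s, hs, (mult_eq_zero_iff k E hacyclic hmult _).2 h⟩
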